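/- For a vector $x$ and an exponent vector $a$ write $x^a=\prod_i x_i^{a_i}$ (with $0^0=1$); products and quotients of vectors are taken coordinatewise; in $(yz/\alpha)^\alpha$ a coordinate with $\alpha_i=0$ contributes the factor $1$. A polynomial $p\in\mathbb{R}[z_1,\dots,z_n]$ is real stable if $p=0$ or $p(z)\neq 0$ for all $z\in\mathbb{C}^n$ with $\operatorname{Im} z_i>0$ for every $i$. A polynomial $P(y_1,\dots,y_n,z_1,\dots,z_n)$ with real coefficients is bistable if $P(y,-z)$ is real stable. $C_p(\kappa)$ denotes the coefficient of $z^\kappa$ in $p$, and $C_P(\kappa,\kappa')$ the coefficient of $y^\kappa z^{\kappa'}$ in $P$. Suprema and infima are taken in the extended real line. Theorem. Let $p(y_1,\dots,y_n)$ and $q(z_1,\dots,z_n)$ be real stable polynomials with nonnegative coefficients. Then $$\sum_{\kappa\in\mathbb{Z}_{\ge 0}^n}\kappa^\kappa\, C_p(\kappa)\,C_q(\kappa)\;\le\;\sup_{\alpha\in\mathbb{R}_{\ge 0}^n}\ \inf_{y,z\in\mathbb{R}_{>0}^n}\frac{p(y)\,q(z)}{(yz/\alpha)^\alpha},$$ and,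 in particular, $$q(\partial z)\,p(z)\big|_{z=0}\;\le\;\sup_{\alpha\in\mathbb{R}_{\ge 0}^n}\ \inf_{y,z\in\mathbb{R}_{>0}^n}\frac{p(y)\,q(z)}{(yz/\alpha)^\alpha},$$ where $q(\partial z)=\sum_\kappa C_q(\kappa)\,\partial_{z_1}^{\kappa_1}\cdots\partial_{z_n}^{\kappa_n}$. The analogue of the first inequality fails for general bistable polynomials in place of $p(y)q(z)$, even multilinear ones: for $n=1$, the polynomial $P(y,z)=1+yz$ is bistable and multilinear with nonnegative coefficients, but $$\sum_{\kappa\in\mathbb{Z}_{\ge 0}}\kappa^\kappa\, C_P(\kappa,\kappa)\;>\;\sup_{\alpha\ge 0}\ \inf_{y,z>0}\frac{P(y,z)}{(yz/\alpha)^\alpha}.$$ -/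

import Mathlib

open MvPolynomial

noncomputable section

namespace StableUpper

/-- A real polynomial is real stable if it is zero, or it has no zero all of whose coordinates
lie in the open upper half plane. -/
def RealStable {σ : Type*} (p : MvPolynomial σ ℝ) : Prop :=
  p = 0 ∨ ∀ z : σ → ℂ, (∀ i, 0 < (z i).im) → aeval z p ≠ 0

/-- All coefficients are nonnegative. -/
def NonnegCoeffs {σ : Type*} (p : MvPolynomial σ ℝ) : Prop :=
  ∀ κ : σ →₀ ℕ, 0 ≤ coeff κ p

/-- All monomials that occur are square-free. -/
def Multilinear {σ : Type*} (p : MvPolynomial σ ℝ) : Prop :=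
  ∀ κ ∈ p.support, ∀ i, κ i ≤ 1

/-- The polynomial `P(y, -z)`, where `y` and `z` are the variables indexed by the left and the
right summand. -/
def negRight {n : ℕ} (P : MvPolynomial (Fin n ⊕ Fin n) ℝ) : MvPolynomial (Fin n ⊕ Fin n) ℝ :=
  aeval (Sum.elim (fun i => X (Sum.inl i)) (fun i => -X (Sum.inr i))) P

/-- `P(y, z)` is bistable if `P(y, -z)` is real stable. -/
def Bistable {n : ℕ} (P : MvPolynomial (Fin n ⊕ Fin n) ℝ) : Prop :=
  RealStable (negRight P)

/-- `x ^ a = ∏ i, x i ^ a i`, with `0 ^ 0 = 1`. -/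
def vecPow {n : ℕ} (x a : Fin n → ℝ) : ℝ :=
  ∏ i, x i ^ a i

/-- `κ ^ κ = ∏ i, κ i ^ κ i`, with `0 ^ 0 = 1`. -/
def selfPow {n : ℕ} (κ : Fin n →₀ ℕ) : ℝ :=
  ∏ i, (κ i : ℝ) ^ κ i

/-- `sup_{α ≥ 0} inf_{y, z > 0} f(y, z) / (y z / α) ^ α`, taken in the extended real line.
A coordinate with `α i = 0` contributes the factor `(y i * z i / 0) ^ 0 = 1`. -/
def supInf {n : ℕ} (f : (Fin n → ℝ) → (Fin n → ℝ) → ℝ) : EReal :=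
  ⨆ (α : Fin n → ℝ) (_ : ∀ i, 0 ≤ α i),
    ⨅ (y : Fin n → ℝ) (_ : ∀ i, 0 < y i) (z : Fin n → ℝ) (_ : ∀ i, 0 < z i),
      ((f y z / vecPow (fun i => y i * z i / α i) α : ℝ) : EReal)

/-- The differential operator `∂₁ ^ κ₁ ⋯ ∂ₙ ^ κₙ` on polynomials. -/
def monomialDiff {n : ℕ} (κ : Fin n →₀ ℕ) :
    Module.End ℝ (MvPolynomial (Fin n) ℝ) :=
  (List.ofFn fun i => ((pderiv i : Derivation ℝ (MvPolynomial (Fin n) ℝ)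
    (MvPolynomial (Fin n) ℝ)) : Module.End ℝ (MvPolynomial (Fin n) ℝ)) ^ κ i).prod

/-- The polynomial `q(∂z) p(z)`. -/
def polyDiff {n : ℕ} (q p : MvPolynomial (Fin n) ℝ) : MvPolynomial (Fin n) ℝ :=
  ∑ κ ∈ q.support, coeff κ q • monomialDiff κ p

end StableUpper

end

open MvPolynomial StableUpper

noncomputable section

/-! Let w κ = κ^κ C_p(κ) C_q(κ), let S be their sum, and read μ = w/S as a probability distribution
on exponents with mean α. The points x_κ = κy/α average to y, so log-concavity of p gives ∏
p(x_κ)^μ_κ ≤ p(y), while weighted AM-GM gives ∏ (C_q(κ) z^κ/μ_κ)^μ_κ ≤ q(z). Bounding p(x_κ) below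
by its single monomial C_p(κ) κ^κ (y/α)^κ and multiplying yields S (yz/α)^α ≤ p(y) q(z), so this α
witnesses the supremum (`RealStable.sum_selfPow_mul_le`). The differential form follows from κ! ≤
κ^κ.

Log-concavity holds because p has only real zeros on lines through the positive orthant
(`RealStable.aeval_line_ne_zero`), hence splits there into real linear factors. This is Gårding's
theory: the homogenization is hyperbolic in direction (0,δ,…,δ), and `HyperbolicAt.add` carries
hyperbolicity to (1,x).

For 1 + yz the sum is 2, while testing the infimum at yz = 2α (at yz = 1/2 if α = 0) keeps the right
side at most 7/4. -/

/-! ### Zeros of polynomials in the unit disc -/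

/-- A complex polynomial without zeros in the open unit disc does not decrease too much
when moving from a boundary point into the disc. -/
theorem Polynomial.norm_eval_mul_pow_le_of_roots {R : Polynomial ℂ} {a z : ℂ} {D : ℕ}
    (hD : R.natDegree ≤ D) (ha : ‖a‖ ≤ 1) (hz : ‖z‖ < 1) (hR : ∀ w, ‖w‖ < 1 → R.eval w ≠ 0) :
    ‖R.eval a‖ * ((1 - ‖z‖) / 2) ^ D ≤ ‖R.eval z‖ := by
  have hR0 : R ≠ 0 := by
    rintro rfl
    exact hR 0 (by simp) (by simp)
  have hs : R.Splits := IsAlgClosed.splits R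
  have hm0 : 0 ≤ (1 - ‖z‖) / 2 := by linarith
  have hm1 : (1 - ‖z‖) / 2 ≤ 1 := by linarith [norm_nonneg z]
  have key : ∀ s : Multiset ℂ, (∀ r ∈ s, 1 ≤ ‖r‖) →
      ‖(s.map (a - ·)).prod‖ * ((1 - ‖z‖) / 2) ^ s.card ≤ ‖(s.map (z - ·)).prod‖ := by
    intro s
    induction s using Multiset.induction with
    | empty => simp
    | cons r s ih =>
      intro h
      have h1 := ih fun r hr => h r (Multiset.mem_cons_of_mem hr)
      have h2 := h r (Multiset.mem_cons_self r s)
      simp only [Multiset.map_cons, Multiset.prod_cons, norm_mul, Multiset.card_cons, pow_succ]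
      have h3 : ‖a - r‖ * ((1 - ‖z‖) / 2) ≤ ‖z - r‖ := by
        have h4 : ‖a - r‖ ≤ 1 + ‖r‖ := (norm_sub_le a r).trans (by linarith)
        have h5 : ‖r‖ - ‖z‖ ≤ ‖z - r‖ := by
          rw [norm_sub_rev]
          exact norm_sub_norm_le r z
        -- Twice the difference of the two sides is (‖r‖ - 1)(1 + ‖z‖).
        have h6 : (1 + ‖r‖) * ((1 - ‖z‖) / 2) ≤ ‖r‖ - ‖z‖ := by
          nlinarith [norm_nonneg z, mul_nonneg (norm_nonneg z) (sub_nonneg.2 h2)]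
        nlinarith
      calc _ = (‖a - r‖ * ((1 - ‖z‖) / 2)) *
            (‖(s.map (a - ·)).prod‖ * ((1 - ‖z‖) / 2) ^ s.card) := by ring
        _ ≤ _ := mul_le_mul h3 h1 (by positivity) (norm_nonneg _)
  have hroots : ∀ r ∈ R.roots, 1 ≤ ‖r‖ := by
    intro r hr
    by_contra! h
    exact hR r h (Polynomial.isRoot_of_mem_roots hr)
  rw [hs.eval_eq_prod_roots, hs.eval_eq_prod_roots, norm_mul, norm_mul, mul_assoc]
  refine mul_le_mul_of_nonneg_left (le_trans ?_ (key _ hroots)) (norm_nonneg _)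
  refine mul_le_mul_of_nonneg_left ?_ (norm_nonneg _)
  exact pow_le_pow_of_le_one hm0 hm1 ((Polynomial.card_roots' R).trans hD)

/-- Along a continuous family of polynomials without zeros on the unit circle,
zeros cannot enter the closed unit disc. -/
theorem Polynomial.eval_ne_zero_of_homotopy {F : ℝ → Polynomial ℂ} {D : ℕ}
    (hD : ∀ s, (F s).natDegree ≤ D) (hF : Continuous fun x : ℝ × ℂ => (F x.1).eval x.2)
    (hc : ∀ s ∈ Set.Icc (0 : ℝ) 1, ∀ z : ℂ, ‖z‖ = 1 → (F s).eval z ≠ 0)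
    (h0 : ∀ z : ℂ, ‖z‖ ≤ 1 → (F 0).eval z ≠ 0) {s : ℝ} (hs : s ∈ Set.Icc (0 : ℝ) 1)
    {z : ℂ} (hz : ‖z‖ ≤ 1) : (F s).eval z ≠ 0 := by
  intro hzero
  let Z : Set (ℝ × ℂ) := (Set.Icc (0 : ℝ) 1 ×ˢ Metric.closedBall (0 : ℂ) 1) ∩
    (fun x : ℝ × ℂ => (F x.1).eval x.2) ⁻¹' {0}
  have hZ : IsCompact Z :=
    (isCompact_Icc.prod (isCompact_closedBall _ _)).inter_right (isClosed_singleton.preimage hF)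
  -- Take the first time `s₀` at which a zero lies in the closed disc. Before it the lower bound at
  -- `z₀` applies with the uniform exponent `D`, and it survives the limit even if the degree drops.
  obtain ⟨⟨s₀, z₀⟩, ⟨⟨hs₀, hz₀⟩, hr₀⟩, hmin⟩ :=
    hZ.exists_isMinOn ⟨(s, z), ⟨hs, by simpa using hz⟩, hzero⟩ continuous_fst.continuousOn
  simp only [Set.mem_preimage, Set.mem_singleton_iff, mem_closedBall_zero_iff] at hs₀ hz₀ hr₀
  have hz₁ : ‖z₀‖ < 1 := lt_of_le_of_ne hz₀ fun h => hc s₀ hs₀ z₀ h hr₀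
  have hspos : 0 < s₀ := lt_of_le_of_ne hs₀.1 fun h => h0 z₀ hz₀ (h ▸ hr₀)
  have hlt : ∀ s ∈ Set.Ioo 0 s₀,
      ‖(F s).eval 1‖ * ((1 - ‖z₀‖) / 2) ^ D ≤ ‖(F s).eval z₀‖ := by
    intro s hs
    refine Polynomial.norm_eval_mul_pow_le_of_roots (hD s) (by simp) hz₁ fun w hw hw0 => ?_
    have hm : s₀ ≤ s := hmin (a := (s, w))
      ⟨⟨⟨hs.1.le, hs.2.le.trans hs₀.2⟩, by simpa using hw.le⟩, hw0⟩
    exact absurd hs.2 hm.not_gt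
  have hcont : ∀ w : ℂ, Continuous fun s => (F s).eval w := fun w =>
    hF.comp (Continuous.prodMk continuous_id continuous_const)
  have hlim : ‖(F s₀).eval 1‖ * ((1 - ‖z₀‖) / 2) ^ D ≤ ‖(F s₀).eval z₀‖ := by
    have hmem : s₀ ∈ closure (Set.Ioo 0 s₀) := by
      rw [closure_Ioo hspos.ne]
      exact ⟨hspos.le, le_rfl⟩
    exact closure_minimal (s := Set.Ioo 0 s₀) hlt (isClosed_le
      (((hcont 1).norm).mul continuous_const) (hcont z₀).norm) hmem
  rw [hr₀, norm_zero] at hlim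
  have h1 : 0 < ‖(F s₀).eval 1‖ := norm_pos_iff.2 (hc s₀ hs₀ 1 (by simp))
  have h2 : 0 < ((1 - ‖z₀‖) / 2) ^ D := pow_pos (by linarith) _
  exact absurd hlim (mul_pos h1 h2).not_ge

theorem MvPolynomial.IsHomogeneous.eval_smul_eq {τ R : Type*} [CommSemiring R]
    {P : MvPolynomial τ R} {d : ℕ} (hP : P.IsHomogeneous d) (c : R) (z : τ → R) :
    eval (fun i => c * z i) P = c ^ d * eval z P := by
  rw [eval_eq, eval_eq, Finset.mul_sum]
  refine Finset.sum_congr rfl fun κ hκ => ?_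
  have h := hP (mem_support_iff.1 hκ)
  simp_rw [mul_pow, Finset.prod_mul_distrib, Finset.prod_pow_eq_pow_sum]
  rw [← h, Finsupp.weight_apply, Finsupp.sum]
  simp only [Pi.one_apply, smul_eq_mul, mul_one]
  ring

/-! ### Hyperbolic directions of homogeneous polynomials -/

section Hyperbolic

variable {τ : Type*}

/-- `P` has no zeros with imaginary part `e`. -/
def MvPolynomial.HyperbolicAt (P : MvPolynomial τ ℂ) (e : τ → ℝ) : Prop :=
  ∀ w : τ → ℝ, eval (fun i => (w i : ℂ) + Complex.I * e i) P ≠ 0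

/-- Dividing the point by `t.im` makes its imaginary part exactly `e`; homogeneity absorbs the
scalar. -/
theorem MvPolynomial.HyperbolicAt.eval_add_mul_ne_zero {P : MvPolynomial τ ℂ} {e : τ → ℝ} {d : ℕ}
    (hP : P.IsHomogeneous d) (he : P.HyperbolicAt e) (w : τ → ℝ) {t : ℂ} (ht : t.im ≠ 0) :
    eval (fun i => (w i : ℂ) + t * e i) P ≠ 0 := by
  have h := he fun i => (w i + t.re * e i) / t.im
  have h2 : (fun i => (w i : ℂ) + t * e i) = fun i => (t.im : ℂ) *
      ((((w i + t.re * e i) / t.im : ℝ) : ℂ) + Complex.I * e i) := by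
    funext i
    have h3 : (t.im : ℂ) ≠ 0 := by exact_mod_cast ht
    conv_lhs => rw [← Complex.re_add_im t]
    push_cast
    field_simp
    ring
  rw [h2, hP.eval_smul_eq]
  exact mul_ne_zero (pow_ne_zero _ (by exact_mod_cast ht)) h

theorem MvPolynomial.HyperbolicAt.add_mul_eval_ne_zero {P : MvPolynomial τ ℂ} {e : τ → ℝ} {d : ℕ}
    (hP : P.IsHomogeneous d) (he : P.HyperbolicAt e) (w : τ → ℝ) {t : ℂ} (ht : t.im ≠ 0) :
    eval (fun i => (e i : ℂ) + t * w i) P ≠ 0 := by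
  have ht0 : t ≠ 0 := by
    rintro rfl
    simp at ht
  have h2 : (fun i => (e i : ℂ) + t * w i) = fun i => t * ((w i : ℂ) + t⁻¹ * e i) := by
    funext i
    field_simp
    ring
  rw [h2, hP.eval_smul_eq]
  refine mul_ne_zero (pow_ne_zero _ ht0) (he.eval_add_mul_ne_zero hP w ?_)
  rw [Complex.inv_im]
  exact div_ne_zero (neg_ne_zero.2 ht) (by simpa using ht0)

/-- Hyperbolicity propagates from `e` to `a + e` if the ray from `a` in direction `e` contains
no zeros. -/
theorem MvPolynomial.HyperbolicAt.add [Fintype τ] {P : MvPolynomial τ ℂ} {a e : τ → ℝ} {d : ℕ}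
    (hP : P.IsHomogeneous d) (he : P.HyperbolicAt e)
    (ha : ∀ t : ℝ, 0 ≤ t → eval (fun i => (a i : ℂ) + t * e i) P ≠ 0) :
    P.HyperbolicAt (a + e) := by
  intro w
  -- Up to the factor 1 - z this is a + r(sw + ie), where r = -i(1+z)/(1-z) is a Cayley map from the
  -- disc to the lower half plane. Clearing the denominator makes it polynomial in z and defined at
  -- z = 1. The target point is s = 1, z = 0, and s is the homotopy parameter.
  let V : ℝ → ℂ → τ → ℂ := fun s z i =>
    (1 - z) * a i + (-Complex.I * (1 + z)) * (s * w i + Complex.I * e i)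
  let F : ℝ → Polynomial ℂ := fun s => aeval (fun i : τ =>
    (1 - Polynomial.X) * Polynomial.C (a i : ℂ) + (Polynomial.C (-Complex.I) *
      (1 + Polynomial.X)) * Polynomial.C ((s : ℂ) * w i + Complex.I * e i)) P
  have hFV : ∀ s z, (F s).eval z = eval (V s z) P := by
    intro s z
    simp only [F, V, ← Polynomial.coe_evalRingHom]
    rw [MvPolynomial.aeval_def, MvPolynomial.hom_eval₂]
    rw [← MvPolynomial.eval₂_id]
    congr 1
    · ext
      all_goals simp
    · funext i
      simp
  have hdeg : ∀ s, (F s).natDegree ≤ P.totalDegree * 1 := by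
    intro s
    refine MvPolynomial.aeval_natDegree_le P le_rfl _ fun i => ?_
    compute_degree
  have hcont : Continuous fun x : ℝ × ℂ => (F x.1).eval x.2 := by
    simp_rw [hFV]
    refine (MvPolynomial.continuous_eval P).comp ?_
    fun_prop
  have hI : ∀ z : ℂ, z ≠ 1 → ‖z‖ ≤ 1 →
      (-Complex.I * (1 + z) / (1 - z)).im ≤ 0 ∧
        (‖z‖ = 1 → (-Complex.I * (1 + z) / (1 - z)).im = 0) := by
    intro z hz1 hz
    have hpos : 0 < Complex.normSq (1 - z) := Complex.normSq_pos.2 (sub_ne_zero.2 hz1.symm)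
    have h : (-Complex.I * (1 + z) / (1 - z)).im = -(1 - ‖z‖ ^ 2) / Complex.normSq (1 - z) := by
      rw [Complex.div_im, ← Complex.normSq_eq_norm_sq, Complex.normSq_apply z]
      simp
      ring
    rw [h]
    refine ⟨div_nonpos_of_nonpos_of_nonneg ?_ hpos.le, fun h1 => by simp [h1]⟩
    nlinarith [norm_nonneg z]
  have hfac : ∀ s z, z ≠ 1 → eval (V s z) P = (1 - z) ^ d * eval (fun i => (a i : ℂ) +
      (-Complex.I * (1 + z) / (1 - z)) * (s * w i + Complex.I * e i)) P := by
    intro s z hz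
    rw [← hP.eval_smul_eq]
    have : 1 - z ≠ 0 := sub_ne_zero.2 hz.symm
    congr 2
    funext i
    simp only [V]
    field_simp
  have hone : ∀ s, eval (V s 1) P ≠ 0 := by
    intro s
    have h1 : V s 1 = fun i => (-2 * Complex.I) *
        (((s * w i : ℝ) : ℂ) + Complex.I * e i) := by
      funext i
      simp only [V]
      push_cast
      ring
    rw [h1, hP.eval_smul_eq]
    exact mul_ne_zero (pow_ne_zero _ (by simp)) (he _)
  have hcirc : ∀ s ∈ Set.Icc (0 : ℝ) 1, ∀ z : ℂ, ‖z‖ = 1 → (F s).eval z ≠ 0 := by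
    intro s _ z hz
    rw [hFV]
    by_cases h1 : z = 1
    · exact h1 ▸ hone s
    rw [hfac s z h1]
    refine mul_ne_zero (pow_ne_zero _ (sub_ne_zero.2 (Ne.symm h1))) ?_
    have hr := (hI z h1 hz.le).2 hz
    generalize -Complex.I * (1 + z) / (1 - z) = r at hr
    obtain ⟨x, rfl⟩ : ∃ x : ℝ, r = x := ⟨r.re, Complex.ext (by simp) (by simpa using hr)⟩
    -- On the circle r is real: x = 0 leaves P(a), and otherwise the imaginary part is a nonzero
    -- multiple of e.
    by_cases h0 : x = 0
    · simpa [h0] using ha 0 le_rfl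
    · convert he.eval_add_mul_ne_zero hP (fun i => a i + x * (s * w i))
        (t := Complex.I * x) (by simpa using h0) using 2
      congr 1
      funext i
      push_cast
      ring
  have hzero : ∀ z : ℂ, ‖z‖ ≤ 1 → (F 0).eval z ≠ 0 := by
    intro z hz
    rw [hFV]
    by_cases h1 : z = 1
    · exact h1 ▸ hone 0
    rw [hfac 0 z h1]
    refine mul_ne_zero (pow_ne_zero _ (sub_ne_zero.2 (Ne.symm h1))) ?_
    have hr := (hI z h1 hz).1
    generalize -Complex.I * (1 + z) / (1 - z) = r at hr
    have h2 : (fun i => (a i : ℂ) + r * (((0 : ℝ) : ℂ) * w i + Complex.I * e i)) =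
        fun i => (a i : ℂ) + (r * Complex.I) * e i := by
      funext i
      push_cast
      ring
    rw [h2]
    -- At s = 0 the point is a + (ir)e with Re(ir) ≥ 0. A real ir lies on the ray covered by `ha`; a
    -- nonreal one is covered by hyperbolicity.
    by_cases h0 : r.re = 0
    · have hr' : r * Complex.I = ((-r.im : ℝ) : ℂ) := by
        apply Complex.ext <;> simp [h0]
      rw [hr']
      exact ha _ (by linarith)
    · exact he.eval_add_mul_ne_zero hP a (by simpa using h0)
  have h := Polynomial.eval_ne_zero_of_homotopy hdeg hcont hcirc hzero
    (s := 1) ⟨zero_le_one, le_rfl⟩ (z := 0) (by simp)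
  rw [hFV] at h
  have hV : V 1 0 = fun i => (-Complex.I) * ((w i : ℂ) + Complex.I * ((a + e) i : ℝ)) := by
    funext i
    simp only [V, Pi.add_apply]
    push_cast
    linear_combination (a i : ℂ) * Complex.I_sq
  rw [hV, hP.eval_smul_eq] at h
  exact right_ne_zero_of_mul h

end Hyperbolic

/-! ### Homogenization and real-rootedness along lines -/

section Homogenization

variable {σ : Type*}

/-- The homogenization of `p` with respect to a new variable, with complex coefficients. -/
def MvPolynomial.complexHomogenization (p : MvPolynomial σ ℝ) : MvPolynomial (Option σ) ℂ :=
  ∑ κ ∈ p.support, monomial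
    (κ.mapDomain some + Finsupp.single none (p.totalDegree - κ.degree)) ((coeff κ p : ℝ) : ℂ)

theorem MvPolynomial.isHomogeneous_complexHomogenization (p : MvPolynomial σ ℝ) :
    p.complexHomogenization.IsHomogeneous p.totalDegree := by
  refine IsHomogeneous.sum _ _ _ fun κ hκ => isHomogeneous_monomial _ ?_
  have h : κ.degree ≤ p.totalDegree := le_totalDegree hκ
  rw [map_add, Finsupp.degree_mapDomain, Finsupp.degree_single]
  omega

variable [Fintype σ]

theorem MvPolynomial.eval_complexHomogenization (p : MvPolynomial σ ℝ) (z : Option σ → ℂ) :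
    eval z p.complexHomogenization = ∑ κ ∈ p.support, ((coeff κ p : ℝ) : ℂ) *
      (z none ^ (p.totalDegree - κ.degree) * ∏ i, z (some i) ^ κ i) := by
  rw [complexHomogenization, map_sum]
  refine Finset.sum_congr rfl fun κ _ => ?_
  rw [eval_monomial, Finsupp.prod_add_index' (by simp) (by simp [pow_add]),
    Finsupp.prod_mapDomain_index (by simp) (by simp [pow_add]), Finsupp.prod_single_index (by simp),
    mul_comm (z none ^ _), Finsupp.prod_fintype _ _ (by simp)]

theorem MvPolynomial.eval_complexHomogenization_of_none_eq_one (p : MvPolynomial σ ℝ)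
    {z : Option σ → ℂ} (hz : z none = 1) :
    eval z p.complexHomogenization = aeval (fun i => z (some i)) p := by
  rw [eval_complexHomogenization, aeval_def, eval₂_eq']
  simp [hz]

theorem MvPolynomial.aeval_ofReal_comp (p : MvPolynomial σ ℝ) (x : σ → ℝ) :
    aeval (fun i => (x i : ℂ)) p = ((eval x p : ℝ) : ℂ) := by
  rw [aeval_def, eval₂_eq', eval_eq']
  simp

theorem MvPolynomial.aeval_conj (p : MvPolynomial σ ℝ) (x : σ → ℂ) :
    aeval (fun i => starRingEnd ℂ (x i)) p = starRingEnd ℂ (aeval x p) := by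
  rw [aeval_def, eval₂_eq', aeval_def, eval₂_eq']
  simp

theorem StableUpper.NonnegCoeffs.le_eval {p : MvPolynomial σ ℝ} (hp : NonnegCoeffs p)
    {x : σ → ℝ} (hx : ∀ i, 0 ≤ x i) (s : Finset (σ →₀ ℕ)) :
    ∑ κ ∈ s, coeff κ p * ∏ i, x i ^ κ i ≤ eval x p := by
  have hnn : ∀ κ : σ →₀ ℕ, 0 ≤ coeff κ p * ∏ i, x i ^ κ i := fun κ =>
    mul_nonneg (hp κ) (Finset.prod_nonneg fun i _ => pow_nonneg (hx i) _)
  rw [eval_eq', ← Finset.sum_filter_add_sum_filter_not s (· ∈ p.support)]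
  rw [Finset.sum_eq_zero (s := s.filter (· ∉ p.support))
    (fun κ hκ => by simp [notMem_support_iff.1 (Finset.mem_filter.1 hκ).2]), add_zero]
  exact Finset.sum_le_sum_of_subset_of_nonneg (fun κ hκ => (Finset.mem_filter.1 hκ).2)
    fun κ _ _ => hnn κ

theorem StableUpper.NonnegCoeffs.eval_nonneg {p : MvPolynomial σ ℝ} (hp : NonnegCoeffs p)
    {x : σ → ℝ} (hx : ∀ i, 0 ≤ x i) : 0 ≤ eval x p := by
  simpa using hp.le_eval hx ∅

theorem StableUpper.NonnegCoeffs.eval_pos {p : MvPolynomial σ ℝ} (hp : NonnegCoeffs p)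
    (hp0 : p ≠ 0) {x : σ → ℝ} (hx : ∀ i, 0 < x i) : 0 < eval x p := by
  obtain ⟨κ, hκ⟩ := support_nonempty.2 hp0
  refine lt_of_lt_of_le ?_ (hp.le_eval (fun i => (hx i).le) {κ})
  rw [Finset.sum_singleton]
  exact mul_pos (lt_of_le_of_ne (hp κ) (mem_support_iff.1 hκ).symm)
    (Finset.prod_pos fun i _ => pow_pos (hx i) _)

theorem StableUpper.RealStable.aeval_ne_zero_of_im_neg {p : MvPolynomial σ ℝ} (hp : RealStable p)
    (hp0 : p ≠ 0) {z : σ → ℂ} (hz : ∀ i, (z i).im < 0) : aeval z p ≠ 0 := by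
  intro h
  refine hp.resolve_left hp0 (fun i => starRingEnd ℂ (z i)) (fun i => by simpa using hz i) ?_
  rw [aeval_conj, h, map_zero]

/-- A polynomial with only real zeros grows in imaginary directions. -/
theorem Polynomial.norm_eval_zero_le_of_real_roots {R : Polynomial ℂ}
    (hR : ∀ t : ℂ, t.im ≠ 0 → R.eval t ≠ 0) (h0 : R.eval 0 ≠ 0) :
    ‖R.eval 0‖ ≤ ‖R.eval (-Complex.I)‖ := by
  have hs : R.Splits := IsAlgClosed.splits R
  have key : ∀ s : Multiset ℂ, (∀ r ∈ s, r.im = 0) →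
      ‖(s.map ((0 : ℂ) - ·)).prod‖ ≤ ‖(s.map (-Complex.I - ·)).prod‖ := by
    intro s
    induction s using Multiset.induction with
    | empty => simp
    | cons r s ih =>
      intro h
      have h1 := ih fun r hr => h r (Multiset.mem_cons_of_mem hr)
      have h2 := h r (Multiset.mem_cons_self r s)
      simp only [Multiset.map_cons, Multiset.prod_cons, norm_mul]
      refine mul_le_mul ?_ h1 (norm_nonneg _) (norm_nonneg _)
      rw [← sq_le_sq₀ (norm_nonneg _) (norm_nonneg _), ← Complex.normSq_eq_norm_sq,
        ← Complex.normSq_eq_norm_sq, Complex.normSq_apply, Complex.normSq_apply]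
      simp [h2]
  rw [hs.eval_eq_prod_roots, hs.eval_eq_prod_roots, norm_mul, norm_mul]
  refine mul_le_mul_of_nonneg_left (key _ fun r hr => ?_) (norm_nonneg _)
  by_contra h
  have hR0 : R ≠ 0 := by
    rintro rfl
    simp at h0
  exact hR r h (Polynomial.isRoot_of_mem_roots hr)

/-- The restriction of a polynomial to the line through `a` in direction `v`. -/
def MvPolynomial.lineRestrict {τ : Type*} (P : MvPolynomial τ ℂ) (a v : τ → ℂ) : Polynomial ℂ :=
  aeval (fun i => Polynomial.C (a i) + Polynomial.X * Polynomial.C (v i)) P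

theorem MvPolynomial.eval_lineRestrict {τ : Type*} (P : MvPolynomial τ ℂ) (a v : τ → ℂ) (t : ℂ) :
    (P.lineRestrict a v).eval t = eval (fun i => a i + t * v i) P := by
  rw [lineRestrict, ← Polynomial.coe_evalRingHom, MvPolynomial.aeval_def, MvPolynomial.hom_eval₂,
    ← MvPolynomial.eval₂_id]
  congr 1
  · ext
    all_goals simp
  · funext i
    simp
    ring

/-- The point `(t, x)`. -/
def optionCons (t : ℝ) (x : σ → ℝ) : Option σ → ℝ := fun o => o.elim t x

/-- Dehomogenizing divides by the real number `w none`, so all imaginary parts become δ / w none: a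
common sign, and stability applies in either half plane. -/
theorem StableUpper.RealStable.eval_add_I_mul_ne_zero_of_none_ne_zero {p : MvPolynomial σ ℝ} (hp : RealStable p)
    (hp0 : p ≠ 0) {δ : ℝ} (hδ : 0 < δ) {w : Option σ → ℝ} (hw : w none ≠ 0) :
    eval (fun i => (w i : ℂ) + Complex.I * optionCons 0 (fun _ => δ) i)
      p.complexHomogenization ≠ 0 := by
  have hw' : (w none : ℂ) ≠ 0 := by exact_mod_cast hw
  have h : (fun i => (w i : ℂ) + Complex.I * optionCons 0 (fun _ => δ) i) =
      fun i => (w none : ℂ) * (((w i : ℂ) + Complex.I * optionCons 0 (fun _ => δ) i) / w none) := by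
    funext i
    field_simp
  rw [h, p.isHomogeneous_complexHomogenization.eval_smul_eq,
    eval_complexHomogenization_of_none_eq_one _ (by simp [optionCons, hw'])]
  refine mul_ne_zero (pow_ne_zero _ hw') ?_
  have him : ∀ i, (((w (some i) : ℂ) + Complex.I * optionCons 0 (fun _ => δ) (some i)) /
      w none).im = δ / w none := by
    intro i
    rw [Complex.div_ofReal_im]
    simp [optionCons]
  rcases lt_or_gt_of_ne hw with h1 | h1
  · exact hp.aeval_ne_zero_of_im_neg hp0 fun i => by
      rw [him]
      exact div_neg_of_pos_of_neg hδ h1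
  · exact hp.resolve_left hp0 _ fun i => by
      rw [him]
      exact div_pos hδ h1

/-- Setting the new variable to 0 leaves the top-degree part, which is positive at a positive
vector. -/
theorem StableUpper.NonnegCoeffs.eval_complexHomogenization_ne_zero {p : MvPolynomial σ ℝ}
    (hp : NonnegCoeffs p) (hp0 : p ≠ 0) {δ : ℝ} (hδ : 0 < δ) :
    eval (fun i => (optionCons 0 (fun _ : σ => δ) i : ℂ)) p.complexHomogenization ≠ 0 := by
  obtain ⟨κ, hκ, hd⟩ : ∃ κ ∈ p.support, κ.degree = p.totalDegree := by
    obtain ⟨κ, hκ, h⟩ := Finset.exists_mem_eq_sup p.support (support_nonempty.2 hp0)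
      fun s => s.degree
    exact ⟨κ, hκ, h.symm⟩
  rw [eval_complexHomogenization]
  have h : (∑ κ ∈ p.support, ((coeff κ p : ℝ) : ℂ) * ((optionCons 0 (fun _ : σ => δ) none : ℂ) ^
      (p.totalDegree - κ.degree) * ∏ i, (optionCons 0 (fun _ : σ => δ) (some i) : ℂ) ^ κ i)) =
      ((∑ κ ∈ p.support, coeff κ p * ((0 : ℝ) ^ (p.totalDegree - κ.degree) *
        ∏ i, δ ^ κ i) : ℝ) : ℂ) := by
    push_cast
    simp [optionCons]
  rw [h, Complex.ofReal_ne_zero]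
  refine (Finset.sum_pos' (fun κ _ => mul_nonneg (hp κ) (by positivity)) ⟨κ, hκ, ?_⟩).ne'
  rw [hd, Nat.sub_self, pow_zero, one_mul]
  exact mul_pos (lt_of_le_of_ne (hp κ) (mem_support_iff.1 hκ).symm)
    (Finset.prod_pos fun i _ => pow_pos hδ _)

theorem StableUpper.RealStable.hyperbolicAt_const {p : MvPolynomial σ ℝ} (hp : RealStable p)
    (hp0 : p ≠ 0) (hn : NonnegCoeffs p) {δ : ℝ} (hδ : 0 < δ) :
    p.complexHomogenization.HyperbolicAt (optionCons 0 fun _ => δ) := by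
  set P := p.complexHomogenization
  have hP : P.IsHomogeneous p.totalDegree := p.isHomogeneous_complexHomogenization
  set e : Option σ → ℝ := optionCons 0 fun _ => δ
  have he0 : eval (fun i => (e i : ℂ)) P ≠ 0 := hn.eval_complexHomogenization_ne_zero hp0 hδ
  -- The bound is uniform in w, so it extends by continuity to `w none = 0`, where dehomogenizing is
  -- impossible. It comes from t ↦ P(e + tw), which has only real zeros, evaluated at 0 and -i.
  have key : ∀ w : Option σ → ℝ, w none ≠ 0 →
      ‖eval (fun i => (e i : ℂ)) P‖ ≤ ‖eval (fun i => (w i : ℂ) + Complex.I * e i) P‖ := by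
    intro w hw
    have h := Polynomial.norm_eval_zero_le_of_real_roots
      (R := P.lineRestrict (fun i => (e i : ℂ)) fun i => (w i : ℂ)) ?_ ?_
    · rw [eval_lineRestrict, eval_lineRestrict] at h
      have h1 : (fun i => (e i : ℂ) + -Complex.I * w i) =
          fun i => -Complex.I * ((w i : ℂ) + Complex.I * e i) := by
        funext i
        linear_combination (e i : ℂ) * Complex.I_sq
      rw [h1, hP.eval_smul_eq] at h
      simpa using h
    · intro t ht
      have ht0 : t ≠ 0 := by
        rintro rfl
        simp at ht
      set u := t⁻¹ with hu
      have hu0 : u.im ≠ 0 := by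
        rw [hu, Complex.inv_im]
        exact div_ne_zero (neg_ne_zero.2 ht) (by simpa using ht0)
      have h1 : (fun i => (e i : ℂ) + t * w i) = fun i => (t * u.im) *
          ((((w i + u.re * e i) / u.im : ℝ) : ℂ) + Complex.I * e i) := by
        funext i
        have h3 : (u.im : ℂ) ≠ 0 := by exact_mod_cast hu0
        have h4 : (e i : ℂ) + t * w i = t * (w i + u * e i) := by
          rw [hu]
          field_simp
          ring
        rw [h4]
        conv_lhs => rw [← Complex.re_add_im u]
        push_cast
        field_simp
        ring
      rw [eval_lineRestrict, h1, hP.eval_smul_eq]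
      refine mul_ne_zero (pow_ne_zero _ (mul_ne_zero ht0 (by exact_mod_cast hu0))) ?_
      refine hp.eval_add_I_mul_ne_zero_of_none_ne_zero hp0 hδ (w := fun i => (w i + u.re * e i) / u.im) ?_
      simp [e, optionCons, hw, hu0]
    · rw [eval_lineRestrict]
      simpa using he0
  intro w
  have hlim : ‖eval (fun i => (e i : ℂ)) P‖ ≤ ‖eval (fun i => (w i : ℂ) + Complex.I * e i) P‖ := by
    let g : ℝ → Option σ → ℝ := fun s => optionCons s fun i => w (some i)
    have hg : ∀ s, ∀ o, g s o = (o.elim s fun i => w (some i)) := fun s o => rfl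
    have hcont : Continuous fun s : ℝ => ‖eval (fun i => (g s i : ℂ) + Complex.I * e i) P‖ := by
      refine ((MvPolynomial.continuous_eval P).comp (continuous_pi fun o => ?_)).norm
      cases o <;> simp only [hg, Option.elim] <;> fun_prop
    have hmem : w none ∈ closure ({0}ᶜ : Set ℝ) := by
      rw [(dense_compl_singleton (0 : ℝ)).closure_eq]
      trivial
    have := closure_minimal (s := ({0}ᶜ : Set ℝ)) (t := {s | ‖eval (fun i => (e i : ℂ)) P‖ ≤
      ‖eval (fun i => (g s i : ℂ) + Complex.I * e i) P‖}) (fun s hs => key (g s) hs)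
      (isClosed_le continuous_const hcont) hmem
    have hw : g (w none) = w := by
      funext o
      cases o <;> rfl
    simpa only [Set.mem_ofPred_eq, hw] using this
  exact norm_pos_iff.1 ((norm_pos_iff.2 he0).trans_le hlim)

/-- A real stable polynomial with nonnegative coefficients is real rooted on each line through
the positive orthant. -/
theorem StableUpper.RealStable.aeval_line_ne_zero {p : MvPolynomial σ ℝ} (hp : RealStable p)
    (hp0 : p ≠ 0) (hn : NonnegCoeffs p) {x : σ → ℝ} (hx : ∀ i, 0 < x i) (v : σ → ℝ) {t : ℂ}
    (ht : t.im ≠ 0) : aeval (fun i => (x i : ℂ) + t * v i) p ≠ 0 := by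
  -- With δ below every x i, (1,x) = (1,x-δ) + (0,δ,…,δ), and the ray from the first summand stays
  -- where p is positive.
  obtain ⟨δ, hδ, hδx⟩ : ∃ δ : ℝ, 0 < δ ∧ ∀ i, δ < x i := by
    have := Filter.eventually_all.2 fun i => Ioo_mem_nhdsGT (hx i)
    obtain ⟨δ, hδ⟩ := (this.and self_mem_nhdsWithin).exists
    exact ⟨δ, hδ.2, fun i => (hδ.1 i).2⟩
  have hP := p.isHomogeneous_complexHomogenization
  have hyp := (hp.hyperbolicAt_const hp0 hn hδ).add hP (a := optionCons 1 fun i => x i - δ) ?_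
  · have h := hyp.add_mul_eval_ne_zero hP (optionCons 0 v) ht
    rw [eval_complexHomogenization_of_none_eq_one _ (by simp [optionCons])] at h
    simpa [optionCons] using h
  · intro s hs
    rw [eval_complexHomogenization_of_none_eq_one _ (by simp [optionCons])]
    have h := aeval_ofReal_comp p fun i => x i - δ + s * δ
    simp only [optionCons, Option.elim]
    push_cast at h ⊢
    rw [h]
    refine Complex.ofReal_ne_zero.2 (hn.eval_pos hp0 fun i => ?_).ne'
    have := hδx i
    have := mul_nonneg hs hδ.le
    linarith

end Homogenization

/-! ### Log-concavity on the positive orthant -/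

section LogConcave

/-- For real x outside [0,1] the function |t - x| is affine on [0,1], so weighted AM-GM handles each
factor. -/
theorem Multiset.norm_prod_sub_rpow_mul_le {t : ℝ} (h0 : 0 ≤ t) (h1 : t ≤ 1) (s : Multiset ℂ)
    (hs : ∀ r ∈ s, ∃ x : ℝ, r = x ∧ x ∉ Set.Icc (0 : ℝ) 1) :
    ‖(s.map ((0 : ℂ) - ·)).prod‖ ^ (1 - t) * ‖(s.map ((1 : ℂ) - ·)).prod‖ ^ t ≤
      ‖(s.map ((t : ℂ) - ·)).prod‖ := by
  induction s using Multiset.induction with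
  | empty => simp
  | cons r s ih =>
    have ih := ih fun r hr => hs r (Multiset.mem_cons_of_mem hr)
    obtain ⟨x, rfl, hx⟩ := hs r (Multiset.mem_cons_self r s)
    simp only [Multiset.map_cons, Multiset.prod_cons, norm_mul]
    rw [Real.mul_rpow (norm_nonneg _) (norm_nonneg _), Real.mul_rpow (norm_nonneg _) (norm_nonneg _)]
    have h2 : ‖(0 : ℂ) - x‖ ^ (1 - t) * ‖(1 : ℂ) - x‖ ^ t ≤ ‖(t : ℂ) - x‖ := by
      have e0 : ‖(0 : ℂ) - x‖ = |0 - x| := by rw [← Real.norm_eq_abs, ← Complex.norm_real]; push_cast; rfl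
      have e1 : ‖(1 : ℂ) - x‖ = |1 - x| := by rw [← Real.norm_eq_abs, ← Complex.norm_real]; push_cast; rfl
      have e2 : ‖(t : ℂ) - x‖ = |t - x| := by rw [← Real.norm_eq_abs, ← Complex.norm_real]; push_cast; rfl
      rw [e0, e1, e2]
      refine (Real.geom_mean_le_arith_mean2_weighted (by linarith) h0 (abs_nonneg _) (abs_nonneg _)
        (by ring)).trans ?_
      rw [Set.mem_Icc, not_and_or, not_le, not_le] at hx
      rcases hx with hx | hx
      · rw [abs_of_pos (by linarith), abs_of_pos (by linarith), abs_of_pos (by linarith)]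
        linarith
      · rw [abs_of_neg (by linarith), abs_of_neg (by linarith), abs_of_neg (by linarith)]
        linarith
    calc _ = (‖(0 : ℂ) - x‖ ^ (1 - t) * ‖(1 : ℂ) - x‖ ^ t) *
          (‖(s.map ((0 : ℂ) - ·)).prod‖ ^ (1 - t) * ‖(s.map ((1 : ℂ) - ·)).prod‖ ^ t) := by ring
      _ ≤ _ := mul_le_mul h2 ih (by positivity) (norm_nonneg _)

variable {σ : Type*} [Fintype σ]

/-- On the segment p is a univariate polynomial with real zeros, none in [0,1] by positivity, so its
linear factors can be compared one by one. -/
theorem StableUpper.RealStable.rpow_mul_rpow_le_eval {p : MvPolynomial σ ℝ} (hp : RealStable p)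
    (hp0 : p ≠ 0) (hn : NonnegCoeffs p) {x y : σ → ℝ} (hx : ∀ i, 0 < x i) (hy : ∀ i, 0 < y i)
    {t : ℝ} (h0 : 0 ≤ t) (h1 : t ≤ 1) :
    eval x p ^ (1 - t) * eval y p ^ t ≤ eval (fun i => (1 - t) * x i + t * y i) p := by
  set R := (map Complex.ofRealHom p).lineRestrict (fun i => (x i : ℂ)) fun i => ((y i - x i : ℝ) : ℂ)
    with hRdef
  have hR : ∀ t, R.eval t = aeval (fun i => (x i : ℂ) + t * ((y i - x i : ℝ) : ℂ)) p := by
    intro t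
    rw [hRdef, eval_lineRestrict, eval_map]
    rfl
  have hRr : ∀ t : ℝ, R.eval (t : ℂ) = ((eval (fun i => (1 - t) * x i + t * y i) p : ℝ) : ℂ) := by
    intro t
    rw [hR, ← aeval_ofReal_comp]
    congr 2
    funext i
    push_cast
    ring
  have hpos : ∀ t ∈ Set.Icc (0 : ℝ) 1, 0 < eval (fun i => (1 - t) * x i + t * y i) p := by
    intro t ht
    refine hn.eval_pos hp0 fun i => ?_
    have := ht.1
    have := ht.2
    have hx := hx i
    have hy := hy i
    rcases ht.1.eq_or_lt with h | h
    · simpa [← h] using hx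
    · have := mul_pos h hy
      have := mul_nonneg (sub_nonneg.2 ht.2) hx.le
      linarith
  have hRn : ∀ t ∈ Set.Icc (0 : ℝ) 1,
      eval (fun i => (1 - t) * x i + t * y i) p = ‖R.eval (t : ℂ)‖ := by
    intro t ht
    rw [hRr, Complex.norm_real, Real.norm_of_nonneg (hpos t ht).le]
  have hroots : ∀ r ∈ R.roots, ∃ x : ℝ, r = x ∧ x ∉ Set.Icc (0 : ℝ) 1 := by
    intro r hr
    have hr0 : R.eval r = 0 := Polynomial.isRoot_of_mem_roots hr
    have him : r.im = 0 := by
      by_contra h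
      rw [hR] at hr0
      exact hp.aeval_line_ne_zero hp0 hn hx _ h hr0
    obtain ⟨s, rfl⟩ : ∃ s : ℝ, r = s := ⟨r.re, Complex.ext (by simp) (by simpa using him)⟩
    refine ⟨s, rfl, fun hs => ?_⟩
    have := hpos s hs
    rw [hRn s hs, hr0, norm_zero] at this
    exact this.false
  have hs : R.Splits := IsAlgClosed.splits R
  have hx' : eval x p = ‖R.eval 0‖ := by simpa using hRn 0 (by simp)
  have hy' : eval y p = ‖R.eval 1‖ := by simpa using hRn 1 (by simp)
  rw [hx', hy', hRn t ⟨h0, h1⟩, hs.eval_eq_prod_roots, hs.eval_eq_prod_roots,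
    hs.eval_eq_prod_roots, norm_mul, norm_mul, norm_mul,
    Real.mul_rpow (norm_nonneg _) (norm_nonneg _), Real.mul_rpow (norm_nonneg _) (norm_nonneg _)]
  have hlc : 0 < ‖R.leadingCoeff‖ := by
    refine norm_pos_iff.2 (Polynomial.leadingCoeff_ne_zero.2 fun h => ?_)
    have := hpos 0 (by simp)
    rw [hRn 0 (by simp), h] at this
    simp at this
  have hl : ‖R.leadingCoeff‖ ^ (1 - t) * ‖R.leadingCoeff‖ ^ t = ‖R.leadingCoeff‖ := by
    rw [← Real.rpow_add hlc]
    simp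
  calc _ = (‖R.leadingCoeff‖ ^ (1 - t) * ‖R.leadingCoeff‖ ^ t) *
        (‖(R.roots.map ((0 : ℂ) - ·)).prod‖ ^ (1 - t) *
          ‖(R.roots.map ((1 : ℂ) - ·)).prod‖ ^ t) := by ring
    _ ≤ _ := by
      rw [hl]
      exact mul_le_mul_of_nonneg_left (Multiset.norm_prod_sub_rpow_mul_le h0 h1 _ hroots)
        (norm_nonneg _)

/-- Real stable polynomials with nonnegative coefficients are log-concave on the positive
orthant. -/
theorem StableUpper.RealStable.concaveOn_log_eval {p : MvPolynomial σ ℝ} (hp : RealStable p)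
    (hp0 : p ≠ 0) (hn : NonnegCoeffs p) :
    ConcaveOn ℝ (Set.pi Set.univ fun _ : σ => Set.Ioi (0 : ℝ)) fun x => Real.log (eval x p) := by
  refine ⟨convex_pi fun i _ => convex_Ioi 0, fun x hx y hy a b ha hb hab => ?_⟩
  have hx' : ∀ i, 0 < x i := fun i => hx i trivial
  have hy' : ∀ i, 0 < y i := fun i => hy i trivial
  have h := hp.rpow_mul_rpow_le_eval hp0 hn hx' hy' hb (by linarith)
  have hxp := hn.eval_pos hp0 hx'
  have hyp := hn.eval_pos hp0 hy'
  have ha' : 1 - b = a := by linarith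
  rw [ha'] at h
  have h2 := Real.log_le_log (mul_pos (Real.rpow_pos_of_pos hxp _) (Real.rpow_pos_of_pos hyp _)) h
  rw [Real.log_mul (Real.rpow_pos_of_pos hxp _).ne' (Real.rpow_pos_of_pos hyp _).ne',
    Real.log_rpow hxp, Real.log_rpow hyp] at h2
  exact h2

theorem StableUpper.NonnegCoeffs.eval_mono {p : MvPolynomial σ ℝ} (hn : NonnegCoeffs p)
    {x y : σ → ℝ} (hx : ∀ i, 0 ≤ x i) (hxy : ∀ i, x i ≤ y i) : eval x p ≤ eval y p := by
  rw [eval_eq', eval_eq']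
  exact Finset.sum_le_sum fun κ _ => mul_le_mul_of_nonneg_left
    (Finset.prod_le_prod (fun i _ => pow_nonneg (hx i) _)
      fun i _ => pow_le_pow_left₀ (hx i) (hxy i) _) (hn κ)

/-- The weighted geometric mean of the values of a real stable polynomial with nonnegative
coefficients is at most its value at the weighted mean. -/
theorem StableUpper.RealStable.prod_rpow_eval_le {p : MvPolynomial σ ℝ} (hp : RealStable p)
    (hp0 : p ≠ 0) (hn : NonnegCoeffs p) {ι : Type*} (s : Finset ι) (w : ι → ℝ) (x : ι → σ → ℝ)
    (hw : ∀ k ∈ s, 0 ≤ w k) (hw1 : ∑ k ∈ s, w k = 1) (hx : ∀ k ∈ s, ∀ i, 0 ≤ x k i) :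
    ∏ k ∈ s, eval (x k) p ^ w k ≤ eval (∑ k ∈ s, w k • x k) p := by
  -- The points may lie on the boundary of the orthant; shift them inside by ε and let ε tend to 0.
  have key : ∀ ε : ℝ, 0 < ε → ∏ k ∈ s, eval (x k) p ^ w k ≤
      eval (∑ k ∈ s, w k • x k + fun _ => ε) p := by
    intro ε hε
    have hpos : ∀ k ∈ s, ∀ i, 0 < (x k + fun _ => ε : σ → ℝ) i := fun k hk i =>
      add_pos_of_nonneg_of_pos (hx k hk i) hε
    have hsum : ∑ k ∈ s, w k • x k + (fun _ => ε) = ∑ k ∈ s, w k • (x k + fun _ => ε) := by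
      simp_rw [smul_add, Finset.sum_add_distrib, ← Finset.sum_smul, hw1, one_smul]
    have hJ := (hp.concaveOn_log_eval hp0 hn).le_map_sum hw hw1
      (p := fun k => x k + fun _ => ε) fun k hk i _ => hpos k hk i
    have hmem : ∀ i, 0 < (∑ k ∈ s, w k • x k + fun _ => ε : σ → ℝ) i := by
      intro i
      rw [Pi.add_apply, Finset.sum_apply]
      exact add_pos_of_nonneg_of_pos
        (Finset.sum_nonneg fun k hk => mul_nonneg (hw k hk) (hx k hk i)) hε
    calc ∏ k ∈ s, eval (x k) p ^ w k ≤ ∏ k ∈ s, eval (x k + fun _ => ε) p ^ w k := by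
          refine Finset.prod_le_prod (fun k hk => Real.rpow_nonneg (hn.eval_nonneg (hx k hk)) _)
            fun k hk => ?_
          refine Real.rpow_le_rpow (hn.eval_nonneg (hx k hk)) ?_ (hw k hk)
          exact hn.eval_mono (hx k hk) fun i => by simpa using hε.le
      _ = Real.exp (∑ k ∈ s, w k • Real.log (eval (x k + fun _ => ε) p)) := by
          rw [Real.exp_sum]
          refine Finset.prod_congr rfl fun k hk => ?_
          rw [Real.rpow_def_of_pos (hn.eval_pos hp0 (hpos k hk)), smul_eq_mul, mul_comm]
      _ ≤ _ := by
          rw [← Real.le_log_iff_exp_le (hn.eval_pos hp0 hmem), hsum]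
          exact hJ
  have hcont : Continuous fun ε : ℝ => eval (∑ k ∈ s, w k • x k + fun _ => ε) p :=
    (MvPolynomial.continuous_eval p).comp (by fun_prop)
  have hmem : (0 : ℝ) ∈ closure (Set.Ioi 0) := by
    rw [closure_Ioi]
    exact Set.self_mem_Ici
  have := closure_minimal (t := {ε | ∏ k ∈ s, eval (x k) p ^ w k ≤
    eval (∑ k ∈ s, w k • x k + fun _ => ε) p}) (fun ε hε => key ε hε)
    (isClosed_le continuous_const hcont) hmem
  have h0 : (∑ k ∈ s, w k • x k + fun _ => (0 : ℝ)) = ∑ k ∈ s, w k • x k := by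
    funext i
    simp
  simpa only [Set.mem_ofPred_eq, h0] using this

end LogConcave

/-! ### The capacity-type upper bound -/

section UpperBound

variable {n : ℕ}

theorem StableUpper.selfPow_pos (κ : Fin n →₀ ℕ) : 0 < selfPow κ := by
  refine Finset.prod_pos fun i _ => ?_
  rcases Nat.eq_zero_or_pos (κ i) with h | h
  · simp [h]
  · exact pow_pos (Nat.cast_pos.2 h) _

/-- Log-concavity for p and AM-GM for q are used with the same weights w/S, whose mean exponent is
α. -/
theorem StableUpper.RealStable.sum_selfPow_mul_le {p q : MvPolynomial (Fin n) ℝ}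
    (hp : RealStable p) (hp0 : p ≠ 0) (hn : NonnegCoeffs p) (hq : NonnegCoeffs q)
    {s : Finset (Fin n →₀ ℕ)} {w : (Fin n →₀ ℕ) → ℝ}
    (hw : ∀ κ, w κ = selfPow κ * coeff κ p * coeff κ q) (hs : ∀ κ ∈ s, 0 < w κ)
    {S : ℝ} (hS : 0 < S) (hsum : ∑ κ ∈ s, w κ = S) {y z : Fin n → ℝ}
    (hy : ∀ i, 0 < y i) (hz : ∀ i, 0 < z i) {α : Fin n → ℝ}
    (hα : ∀ i, α i = ∑ κ ∈ s, w κ / S * κ i) :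
    S * vecPow (fun i => y i * z i / α i) α ≤ eval y p * eval z q := by
  have hw1 : ∑ κ ∈ s, w κ / S = 1 := by rw [← Finset.sum_div, hsum, div_self hS.ne']
  have hμ : ∀ κ ∈ s, 0 < w κ / S := fun κ hκ => div_pos (hs κ hκ) hS
  have hα0 : ∀ i, 0 ≤ α i := fun i => by
    rw [hα]
    exact Finset.sum_nonneg fun κ hκ => mul_nonneg (hμ κ hκ).le (Nat.cast_nonneg _)
  have hκ0 : ∀ i, α i = 0 → ∀ κ ∈ s, κ i = 0 := by
    intro i hi κ hκ
    rw [hα, Finset.sum_eq_zero_iff_of_nonneg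
      fun κ hκ => mul_nonneg (hμ κ hκ).le (Nat.cast_nonneg _)] at hi
    simpa [(hμ κ hκ).ne'] using hi κ hκ
  -- If α i = 0, every κ in s has κ i = 0; the value y i then keeps the mean equal to y and
  -- contributes y i ^ 0 to the monomial.
  let x : (Fin n →₀ ℕ) → Fin n → ℝ := fun κ i => if α i = 0 then y i else y i / α i * κ i
  have hx : ∀ κ ∈ s, ∀ i, 0 ≤ x κ i := by
    intro κ _ i
    simp only [x]
    split_ifs
    · exact (hy i).le
    · exact mul_nonneg (div_nonneg (hy i).le (hα0 i)) (Nat.cast_nonneg _)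
  have hxsum : ∑ κ ∈ s, (w κ / S) • x κ = y := by
    funext i
    rw [Finset.sum_apply]
    simp only [Pi.smul_apply, smul_eq_mul, x]
    split_ifs with h
    · rw [← Finset.sum_mul, hw1, one_mul]
    · calc _ = y i / α i * ∑ κ ∈ s, w κ / S * κ i := by
            rw [Finset.mul_sum]
            exact Finset.sum_congr rfl fun κ _ => by ring
        _ = y i := by
            rw [← hα]
            field_simp
  have hxκ : ∀ κ ∈ s, ∏ i, x κ i ^ κ i = selfPow κ * ∏ i, (y i / α i) ^ κ i := by
    intro κ hκ
    rw [selfPow, ← Finset.prod_mul_distrib]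
    refine Finset.prod_congr rfl fun i _ => ?_
    by_cases h : α i = 0
    · simp [hκ0 i h κ hκ]
    · simp only [x, if_neg h]
      rw [mul_pow, mul_comm]
  have hP := hp.prod_rpow_eval_le hp0 hn s (fun κ => w κ / S) x (fun κ hκ => (hμ κ hκ).le) hw1 hx
  rw [hxsum] at hP
  have hQ := Real.geom_mean_le_arith_mean_weighted s (fun κ => w κ / S)
    (fun κ => coeff κ q * (∏ i, z i ^ κ i) / (w κ / S)) (fun κ hκ => (hμ κ hκ).le) hw1
    fun κ hκ => div_nonneg (mul_nonneg (hq κ)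
      (Finset.prod_nonneg fun i _ => pow_nonneg (hz i).le _)) (hμ κ hκ).le
  have hQ2 : ∑ κ ∈ s, w κ / S * (coeff κ q * (∏ i, z i ^ κ i) / (w κ / S)) ≤ eval z q := by
    refine le_trans (le_of_eq (Finset.sum_congr rfl fun κ hκ => ?_))
      (hq.le_eval (fun i => (hz i).le) s)
    exact mul_div_cancel₀ _ (hμ κ hκ).ne'
  have hb : ∀ i, 0 ≤ y i * z i / α i := fun i =>
    div_nonneg (mul_nonneg (hy i).le (hz i).le) (hα0 i)
  calc S * vecPow (fun i => y i * z i / α i) α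
      = ∏ κ ∈ s, (S * ∏ i, (y i * z i / α i) ^ κ i) ^ (w κ / S) := by
        have h1 : ∀ κ ∈ s, (S * ∏ i, (y i * z i / α i) ^ κ i) ^ (w κ / S) =
            S ^ (w κ / S) * ∏ i, (y i * z i / α i) ^ (w κ / S * κ i) := by
          intro κ hκ
          rw [Real.mul_rpow hS.le (Finset.prod_nonneg fun i _ => pow_nonneg (hb i) _),
            ← Real.finsetProd_rpow _ _ fun i _ => pow_nonneg (hb i) _]
          congr 1
          refine Finset.prod_congr rfl fun i _ => ?_
          rw [← Real.rpow_natCast, ← Real.rpow_mul (hb i), mul_comm (w κ / S)]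
        rw [Finset.prod_congr rfl h1, Finset.prod_mul_distrib, Finset.prod_comm,
          ← Real.rpow_sum_of_pos hS, hw1, Real.rpow_one, vecPow]
        congr 1
        refine Finset.prod_congr rfl fun i _ => ?_
        rw [← Real.rpow_sum_of_nonneg (hb i)
          fun κ hκ => mul_nonneg (hμ κ hκ).le (Nat.cast_nonneg _), ← hα]
    _ ≤ ∏ κ ∈ s, eval (x κ) p ^ (w κ / S) *
          (coeff κ q * (∏ i, z i ^ κ i) / (w κ / S)) ^ (w κ / S) := by
        refine Finset.prod_le_prod (fun κ hκ => Real.rpow_nonneg (mul_nonneg hS.le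
          (Finset.prod_nonneg fun i _ => pow_nonneg (hb i) _)) _) fun κ hκ => ?_
        have hz0 : 0 ≤ coeff κ q * (∏ i, z i ^ κ i) / (w κ / S) := div_nonneg (mul_nonneg (hq κ)
          (Finset.prod_nonneg fun i _ => pow_nonneg (hz i).le _)) (hμ κ hκ).le
        rw [← Real.mul_rpow (hn.eval_nonneg (hx κ hκ)) hz0]
        refine Real.rpow_le_rpow (mul_nonneg hS.le
          (Finset.prod_nonneg fun i _ => pow_nonneg (hb i) _)) ?_ (hμ κ hκ).le
        have hle := hn.le_eval (hx κ hκ) {κ}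
        rw [Finset.sum_singleton, hxκ κ hκ] at hle
        -- Dividing κ^κ C_p(κ) C_q(κ) = w κ by the weight w κ / S leaves exactly S, for every κ.
        refine le_trans (le_of_eq ?_) (mul_le_mul_of_nonneg_right hle hz0)
        have hwκ := (hs κ hκ).ne'
        have h2 : ∏ i, (y i * z i / α i) ^ κ i = (∏ i, (y i / α i) ^ κ i) * ∏ i, z i ^ κ i := by
          rw [← Finset.prod_mul_distrib]
          exact Finset.prod_congr rfl fun i _ => by rw [← mul_pow]; ring
        rw [h2]
        calc _ = w κ / w κ * (S * ((∏ i, (y i / α i) ^ κ i) * ∏ i, z i ^ κ i)) := by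
              rw [div_self hwκ, one_mul]
          _ = selfPow κ * coeff κ p * coeff κ q / w κ *
                (S * ((∏ i, (y i / α i) ^ κ i) * ∏ i, z i ^ κ i)) := by rw [← hw]
          _ = _ := by
              field_simp
    _ = (∏ κ ∈ s, eval (x κ) p ^ (w κ / S)) *
          ∏ κ ∈ s, (coeff κ q * (∏ i, z i ^ κ i) / (w κ / S)) ^ (w κ / S) :=
        Finset.prod_mul_distrib
    _ ≤ eval y p * eval z q := by
        refine mul_le_mul hP (hQ.trans hQ2) ?_ (hn.eval_nonneg fun i => (hy i).le)
        exact Finset.prod_nonneg fun κ hκ => Real.rpow_nonneg (div_nonneg (mul_nonneg (hq κ)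
          (Finset.prod_nonneg fun i _ => pow_nonneg (hz i).le _)) (hμ κ hκ).le) _

theorem StableUpper.le_supInf {f : (Fin n → ℝ) → (Fin n → ℝ) → ℝ} {S : ℝ} (α : Fin n → ℝ)
    (hα : ∀ i, 0 ≤ α i) (h : ∀ y z, (∀ i, 0 < y i) → (∀ i, 0 < z i) →
      S ≤ f y z / vecPow (fun i => y i * z i / α i) α) : (S : EReal) ≤ supInf f := by
  refine le_iSup₂_of_le α hα ?_
  exact le_iInf₂ fun y hy => le_iInf₂ fun z hz => EReal.coe_le_coe_iff.2 (h y z hy hz)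

theorem StableUpper.RealStable.finsum_selfPow_mul_le_supInf {p q : MvPolynomial (Fin n) ℝ}
    (hp : RealStable p) (hn : NonnegCoeffs p) (hq : NonnegCoeffs q) :
    ((∑ᶠ κ : Fin n →₀ ℕ, selfPow κ * coeff κ p * coeff κ q : ℝ) : EReal) ≤
      supInf fun y z => eval y p * eval z q := by
  set w : (Fin n →₀ ℕ) → ℝ := fun κ => selfPow κ * coeff κ p * coeff κ q with hw
  have hw0 : ∀ κ, 0 ≤ w κ := fun κ =>
    mul_nonneg (mul_nonneg (selfPow_pos κ).le (hn κ)) (hq κ)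
  have hfin : (Function.support w).Finite := by
    refine p.support.finite_toSet.subset fun κ hκ => ?_
    rw [Finset.mem_coe, mem_support_iff]
    exact right_ne_zero_of_mul (left_ne_zero_of_mul hκ)
  rw [finsum_eq_sum w hfin]
  set s := hfin.toFinset
  have hs : ∀ κ ∈ s, 0 < w κ := fun κ hκ =>
    lt_of_le_of_ne (hw0 κ) (Ne.symm (by simpa [s] using hκ))
  rcases s.eq_empty_or_nonempty with h | h
  · rw [h, Finset.sum_empty]
    refine le_supInf 0 (fun _ => le_rfl) fun y z hy hz => ?_
    refine div_nonneg (mul_nonneg (hn.eval_nonneg fun i => (hy i).le)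
      (hq.eval_nonneg fun i => (hz i).le)) ?_
    simp [vecPow]
  · have hS : 0 < ∑ κ ∈ s, w κ := Finset.sum_pos hs h
    have hp0 : p ≠ 0 := by
      rintro rfl
      obtain ⟨κ, hκ⟩ := h
      have := hs κ hκ
      simp [hw] at this
    have hα : ∀ i, 0 ≤ ∑ κ ∈ s, w κ / (∑ κ ∈ s, w κ) * κ i := fun i =>
      Finset.sum_nonneg fun κ _ => mul_nonneg (div_nonneg (hw0 κ) hS.le) (Nat.cast_nonneg _)
    refine le_supInf (fun i => ∑ κ ∈ s, w κ / (∑ κ ∈ s, w κ) * κ i) hα fun y z hy hz => ?_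
    rw [le_div_iff₀]
    · exact hp.sum_selfPow_mul_le hp0 hn hq (fun κ => rfl) hs hS rfl hy hz fun i => rfl
    · refine Finset.prod_pos fun i _ => ?_
      rcases (hα i).eq_or_lt with h0 | h0
      · simp [← h0]
      · exact Real.rpow_pos_of_pos (div_pos (mul_pos (hy i) (hz i)) h0) _

end UpperBound

/-! ### The differential operator form -/

section Differential

variable {n : ℕ}

theorem MvPolynomial.coeff_pderiv_pow {σ : Type*} (i : σ) (k : ℕ) (p : MvPolynomial σ ℝ)
    (m : σ →₀ ℕ) :
    coeff m ((((pderiv i : Derivation ℝ (MvPolynomial σ ℝ) (MvPolynomial σ ℝ)) :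
      Module.End ℝ (MvPolynomial σ ℝ)) ^ k) p) =
      coeff (m + Finsupp.single i k) p * ((m i + 1).ascFactorial k : ℝ) := by
  induction k generalizing m with
  | zero => simp
  | succ k ih =>
    rw [pow_succ', Module.End.mul_apply, Derivation.coeFn_coe, coeff_pderiv, ih, add_assoc,
      ← Finsupp.single_add, add_comm 1 k, mul_assoc]
    congr 1
    rw [Finsupp.add_apply, Finsupp.single_eq_same, Nat.ascFactorial_succ,
      ← Nat.succ_ascFactorial]
    push_cast
    ring

/-- Differentiating in one variable leaves the other exponents alone, so with no repetitions each
factor reads the original `m i`. -/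
theorem MvPolynomial.coeff_list_prod_pderiv_pow {σ : Type*} (κ : σ → ℕ) (l : List σ)
    (hl : l.Nodup) (p : MvPolynomial σ ℝ) (m : σ →₀ ℕ) :
    coeff m ((l.map fun i => ((pderiv i : Derivation ℝ (MvPolynomial σ ℝ) (MvPolynomial σ ℝ)) :
      Module.End ℝ (MvPolynomial σ ℝ)) ^ κ i).prod p) =
      coeff (m + (l.map fun i => Finsupp.single i (κ i)).sum) p *
        (l.map fun i => ((m i + 1).ascFactorial (κ i) : ℝ)).prod := by
  induction l generalizing m with
  | nil => simp
  | cons i l ih =>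
    rw [List.nodup_cons] at hl
    simp only [List.map_cons, List.prod_cons, List.sum_cons]
    rw [Module.End.mul_apply, coeff_pderiv_pow, ih hl.2, add_assoc, mul_assoc,
      mul_comm _ (((m i + 1).ascFactorial (κ i) : ℕ) : ℝ)]
    congr 3
    refine List.map_congr_left fun j hj => ?_
    have hij : i ≠ j := fun h => hl.1 (h ▸ hj)
    simp [Finsupp.single_eq_of_ne hij.symm]

theorem StableUpper.eval_zero_polyDiff (q p : MvPolynomial (Fin n) ℝ) :
    eval 0 (polyDiff q p) =
      ∑ κ ∈ q.support, (∏ i, ((κ i).factorial : ℝ)) * coeff κ p * coeff κ q := by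
  rw [polyDiff, map_sum]
  refine Finset.sum_congr rfl fun κ _ => ?_
  have h : eval 0 (monomialDiff κ p) = coeff κ p * ∏ i, ((κ i).factorial : ℝ) := by
    rw [eval_zero, constantCoeff_eq, monomialDiff, List.ofFn_eq_map, coeff_list_prod_pderiv_pow _ _ (List.nodup_finRange n)]
    rw [← List.ofFn_eq_map, ← List.ofFn_eq_map, List.sum_ofFn, List.prod_ofFn, zero_add,
      Finsupp.univ_sum_single]
    simp [Nat.one_ascFactorial]
  rw [smul_eval, h]
  ring

theorem StableUpper.eval_zero_polyDiff_le {p q : MvPolynomial (Fin n) ℝ} (hn : NonnegCoeffs p)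
    (hq : NonnegCoeffs q) :
    eval 0 (polyDiff q p) ≤ ∑ᶠ κ : Fin n →₀ ℕ, selfPow κ * coeff κ p * coeff κ q := by
  rw [eval_zero_polyDiff, finsum_eq_sum_of_support_subset (s := q.support)]
  · refine Finset.sum_le_sum fun κ _ => ?_
    refine mul_le_mul_of_nonneg_right (mul_le_mul_of_nonneg_right ?_ (hn κ)) (hq κ)
    refine Finset.prod_le_prod (fun _ _ => Nat.cast_nonneg _) fun i _ => ?_
    exact_mod_cast Nat.factorial_le_pow (κ i)
  · intro κ hκ
    rw [Finset.mem_coe, mem_support_iff]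
    exact right_ne_zero_of_mul hκ

end Differential

/-! ### The bistable counterexample 1 + yz -/

section Counterexample

/-- The polynomial `1 + y z`. -/
def onePlusProd : MvPolynomial (Fin 1 ⊕ Fin 1) ℝ := 1 + X (Sum.inl 0) * X (Sum.inr 0)

theorem coeff_onePlusProd (m : Fin 1 ⊕ Fin 1 →₀ ℕ) :
    coeff m onePlusProd = (if 0 = m then 1 else 0) +
      if Finsupp.single (Sum.inl 0) 1 + Finsupp.single (Sum.inr 0) 1 = m then 1 else 0 := by
  rw [onePlusProd, X, X, monomial_mul, coeff_add, coeff_one, coeff_monomial, mul_one]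

theorem bistable_onePlusProd : Bistable onePlusProd := by
  refine Or.inr fun z hz h => ?_
  have h1 : z (Sum.inl 0) * z (Sum.inr 0) = 1 := by
    simp only [negRight, onePlusProd, map_add, map_mul, map_one, aeval_X, Sum.elim_inl,
      Sum.elim_inr, map_neg] at h
    linear_combination -h
  have h0 := hz (Sum.inl 0)
  have h2 := hz (Sum.inr 0)
  -- A zero of 1 - yz has z = 1/y, and inversion sends the upper half plane to the lower one.
  rw [eq_inv_of_mul_eq_one_right h1, Complex.inv_im] at h2
  have : 0 ≤ Complex.normSq (z (Sum.inl 0)) := Complex.normSq_nonneg _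
  exact absurd h2 (div_nonpos_of_nonpos_of_nonneg (by linarith) this).not_gt

theorem nonnegCoeffs_onePlusProd : NonnegCoeffs onePlusProd := by
  intro m
  rw [coeff_onePlusProd]
  split_ifs <;> norm_num

theorem multilinear_onePlusProd : Multilinear onePlusProd := by
  intro m hm i
  rw [mem_support_iff, coeff_onePlusProd] at hm
  by_cases h1 : 0 = m
  · simp [← h1]
  by_cases h2 : Finsupp.single (Sum.inl 0) 1 + Finsupp.single (Sum.inr 0) 1 = m
  · rw [← h2]
    rcases i with i | i <;> simp [Fin.fin_one_eq_zero i]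
  · simp [h1, h2] at hm

theorem finsum_selfPow_mul_coeff_onePlusProd :
    ∑ᶠ κ : Fin 1 →₀ ℕ, selfPow κ * coeff (Finsupp.sumElim κ κ) onePlusProd = 2 := by
  have hne : (0 : Fin 1 →₀ ℕ) ≠ Finsupp.single 0 1 := fun h => by
    simpa using DFunLike.congr_fun h 0
  have h0 : Finsupp.single (Sum.inl (0 : Fin 1)) 1 + Finsupp.single (Sum.inr (0 : Fin 1)) 1 =
      Finsupp.sumElim (Finsupp.single 0 1) (Finsupp.single 0 1) :=
    (Finsupp.sumElim_single_single _ _ _ _).symm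
  have hinj : ∀ a b : Fin 1 →₀ ℕ, Finsupp.sumElim a a = Finsupp.sumElim b b ↔ a = b := by
    refine fun a b => ⟨fun h => ?_, fun h => h ▸ rfl⟩
    exact Finsupp.ext fun i => DFunLike.congr_fun h (Sum.inl i)
  have hco : ∀ κ : Fin 1 →₀ ℕ, coeff (Finsupp.sumElim κ κ) onePlusProd =
      (if 0 = κ then 1 else 0) + if Finsupp.single 0 1 = κ then 1 else 0 := by
    intro κ
    rw [coeff_onePlusProd, h0, ← Finsupp.sumElim_zero_zero]
    simp only [hinj]
  rw [finsum_eq_sum_of_support_subset (s := {0, Finsupp.single 0 1}), Finset.sum_pair hne, hco, hco]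
  · simp [selfPow, hne, hne.symm]
    norm_num
  · intro κ hκ
    have := right_ne_zero_of_mul hκ
    rw [hco] at this
    by_contra h
    simp only [Finset.coe_insert, Finset.coe_singleton, Set.mem_insert_iff,
      Set.mem_singleton_iff, not_or] at h
    simp [Ne.symm h.1, Ne.symm h.2] at this

/-- The convex function 2^a lies above its tangent at a = 1, and 7/4 times that tangent already
dominates 1 + 2a for a ≥ 0. -/
theorem one_add_two_mul_div_two_rpow_le {a : ℝ} (ha : 0 ≤ a) :
    (1 + 2 * a) / (2 : ℝ) ^ a ≤ 7 / 4 := by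
  rw [div_le_iff₀ (Real.rpow_pos_of_pos two_pos _)]
  have h1 : (2 : ℝ) ^ a = 2 * Real.exp (Real.log 2 * (a - 1)) := by
    rw [← Real.rpow_def_of_pos two_pos, Real.rpow_sub_one two_ne_zero]
    ring
  have h2 := Real.add_one_le_exp (Real.log 2 * (a - 1))
  have h3 := Real.log_two_gt_d9
  have h4 := Real.log_two_lt_d9
  rw [h1]
  nlinarith

theorem supInf_onePlusProd_le :
    supInf (fun y z : Fin 1 → ℝ => eval (Sum.elim y z) onePlusProd) ≤ ((7 / 4 : ℝ) : EReal) := by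
  refine iSup₂_le fun α hα => ?_
  have hev : ∀ y z : Fin 1 → ℝ, eval (Sum.elim y z) onePlusProd = 1 + y 0 * z 0 := by
    intro y z
    simp [onePlusProd]
  rcases (hα 0).eq_or_lt with h0 | h0
  · refine iInf₂_le_of_le (fun _ => 1 / 2) (fun _ => by norm_num)
      (iInf₂_le_of_le (fun _ => 1) (fun _ => one_pos) (EReal.coe_le_coe_iff.2 ?_))
    beta_reduce
    rw [hev]
    simp [vecPow, ← h0]
    norm_num
  -- This choice makes yz/α = 2, so the quotient is (1 + 2α)/2^α.
  · refine iInf₂_le_of_le (fun _ => 2 * α 0) (fun _ => by positivity)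
      (iInf₂_le_of_le (fun _ => 1) (fun _ => one_pos) (EReal.coe_le_coe_iff.2 ?_))
    beta_reduce
    rw [hev]
    have h := one_add_two_mul_div_two_rpow_le h0.le
    have h2 : 2 * α 0 * 1 / α 0 = 2 := by field_simp
    simpa [vecPow, h0.ne'] using h

end Counterexample

end

theorem mainTheorem4 :
    (∀ (n : ℕ) (p q : MvPolynomial (Fin n) ℝ),
      StableUpper.RealStable p → StableUpper.RealStable q →
      StableUpper.NonnegCoeffs p → StableUpper.NonnegCoeffs q →
        ((∑ᶠ κ : Fin n →₀ ℕ, StableUpper.selfPow κ * MvPolynomial.coeff κ p *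
            MvPolynomial.coeff κ q : ℝ) : EReal)
          ≤ StableUpper.supInf
              (fun y z : Fin n → ℝ => MvPolynomial.eval y p * MvPolynomial.eval z q) ∧
        ((MvPolynomial.eval 0 (StableUpper.polyDiff q p) : ℝ) : EReal)
          ≤ StableUpper.supInf
              (fun y z : Fin n → ℝ => MvPolynomial.eval y p * MvPolynomial.eval z q)) ∧
    (∃ P : MvPolynomial (Fin 1 ⊕ Fin 1) ℝ,
      P = 1 + MvPolynomial.X (Sum.inl 0) * MvPolynomial.X (Sum.inr 0) ∧
      StableUpper.Bistable P ∧ StableUpper.NonnegCoeffs P ∧ StableUpper.Multilinear P ∧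
        StableUpper.supInf (fun y z : Fin 1 → ℝ => MvPolynomial.eval (Sum.elim y z) P)
          < ((∑ᶠ κ : Fin 1 →₀ ℕ, StableUpper.selfPow κ *
              MvPolynomial.coeff (Finsupp.sumElim κ κ) P : ℝ) : EReal)) := by
  refine ⟨fun n p q hp _ hn hq => ?_, onePlusProd, rfl, bistable_onePlusProd,
    nonnegCoeffs_onePlusProd, multilinear_onePlusProd, ?_⟩
  · have h := hp.finsum_selfPow_mul_le_supInf hn hq
    exact ⟨h, (EReal.coe_le_coe_iff.2 (eval_zero_polyDiff_le hn hq)).trans h⟩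
  · rw [finsum_selfPow_mul_coeff_onePlusProd]
    exact supInf_onePlusProd_le.trans_lt (EReal.coe_lt_coe_iff.2 (by norm_num))
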